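/- Notation. For $x\in\mathbb{R}^d$ let $\|x\|_p=\big(\sum_{i}|x_i|^p\big)^{1/p}$ for $0<p<\infty$ and $\|x\|_\infty=\max_i|x_i|$; let $[t]_-=\min\{0,t\}$, $[t]_+=\max\{0,t\}$ and $1/\infty=0$. A feedforward ReLU network $f:\mathbb{R}^d\to\mathbb{R}$ is a map $f=T^{(L)}\circ[\cdot]_+\circ T^{(L-1)}\circ\cdots\circ[\cdot]_+\circ T^{(1)}$ with affine maps $T^{(l)}:\mathbb{R}^{d_{l-1}}\to\mathbb{R}^{d_l}$, $d_0=d$, $d_L=1$, and $[\cdot]_+$ applied coordinatewise; its depth is $L$ and its width is $\max\{d_1,\dots,d_{L-1}\}$. A dataset of size $N$ in $\mathbb{R}^d$ with $C$ classes consists of labelled points $(x_i,y_i)\in\mathbb{R}^d\times\{1,\dots,C\}$, $i=1,\dots,N$; it is $(\delta,q)$-separated if $\min\{\|x_i-x_j\|_q : y_i\neq y_j\}=\delta$ (in particular, at least two labels occur). A function $f:\mathbb{R}^d\to\mathbb{R}$ $(\sigma,p)$-robustly memorizes the dataset if $f(x)=y_i$ for every $i$ and every $x\in\mathbb{R}^d$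 with $\|x-x_i\|_p\le\sigma$. Theorem. There is a universal constant $c>0$ such that the following holds for all integers $N,d,C\ge 2$ and $k$ with $7\le k\le d+5$, all $p\in(0,\infty]$ and $q\in[1,\infty]$, and all reals $\delta>0$ and $\sigma\ge 0$. Put $$a_{p,q,d}=\frac{1}{8\sqrt e}\,d^{-\frac12+\left[\frac12-\frac1q\right]_-+\left[\frac1p-\frac12\right]_-}.$$ If $$\frac{\sigma}{\delta}\le a_{p,q,d}\,N^{-\frac{2}{k-6}},$$ then for every $(\delta,q)$-separated dataset of size $N$ in $\mathbb{R}^d$ with $C$ classes there exists a feedforward ReLU network $f:\mathbb{R}^d\to\mathbb{R}$ of width $k$ and depth at most $c\,N k\log_2 k$ that $(\sigma,p)$-robustly memorizes the dataset. -/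

import Mathlib

open scoped ENNReal

namespace RobustMemo

/-- The `ℓ_p` (quasi-)norm on `ℝ^d` for `p ∈ (0, ∞]`: Mathlib's norm on `PiLp p`, which is
`(∑ i, |x i| ^ p) ^ (1 / p)` for `0 < p < ∞` (also for `p < 1`) and `max_i |x i|` for `p = ∞`. -/
noncomputable def lpNorm {d : ℕ} (p : ℝ≥0∞) (x : Fin d → ℝ) : ℝ :=
  ‖(WithLp.toLp p x : PiLp p (fun _ : Fin d => ℝ))‖

/-- The closed `ℓ_p` ball `B_p^d(x, r)`. -/
def lpBall {d : ℕ} (p : ℝ≥0∞) (x : Fin d → ℝ) (r : ℝ) : Set (Fin d → ℝ) :=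
  {x' | lpNorm p (x' - x) ≤ r}

/-- A feedforward ReLU network with input dimension `n` and output dimension `m`:
`T^(L) ∘ [·]₊ ∘ T^(L-1) ∘ ⋯ ∘ [·]₊ ∘ T^(1)` with affine maps `T^(l) x = W^(l) x + b^(l)`.
`affine` is the last affine map; `hidden W b g` puts the hidden layer `x ↦ [W x + b]₊` of `h`
neurons in front of the network `g`. -/
inductive ReLUNet : ℕ → ℕ → Type
  | affine {n m : ℕ} (W : Matrix (Fin m) (Fin n) ℝ) (b : Fin m → ℝ) : ReLUNet n m
  | hidden {n h m : ℕ} (W : Matrix (Fin h) (Fin n) ℝ) (b : Fin h → ℝ)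
      (g : ReLUNet h m) : ReLUNet n m

namespace ReLUNet

/-- The function computed by a network. -/
noncomputable def eval : {n m : ℕ} → ReLUNet n m → (Fin n → ℝ) → (Fin m → ℝ)
  | _, _, affine W b, x => W.mulVec x + b
  | _, _, hidden W b g, x => g.eval (fun i => max 0 ((W.mulVec x + b) i))

/-- The depth `L`: the number of affine maps. -/
def depth : {n m : ℕ} → ReLUNet n m → ℕ
  | _, _, affine _ _ => 1
  | _, _, hidden _ _ g => g.depth + 1

/-- The width `max {d_1, …, d_{L-1}}`: the largest number of neurons in a hidden layer
(`0` if there is no hidden layer). -/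
def width : {n m : ℕ} → ReLUNet n m → ℕ
  | _, _, affine _ _ => 0
  | _, _, hidden (h := h) _ _ g => max h g.width

/-- The real-valued function `ℝ^d → ℝ` computed by a network with output dimension `1`. -/
noncomputable def toFun {d : ℕ} (F : ReLUNet d 1) (x : Fin d → ℝ) : ℝ := F.eval x 0

end ReLUNet

/-- A dataset of `N` labelled points `(x_i, y_i) ∈ ℝ^d × {1, …, C}`. -/
structure Dataset (d N C : ℕ) where
  point : Fin N → (Fin d → ℝ)
  label : Fin N → ℕ
  label_mem : ∀ i, label i ∈ Set.Icc 1 C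

/-- `(δ, q)`-separation: `δ = min {‖x_i - x_j‖_q | y_i ≠ y_j}`
(in particular at least two labels occur). -/
def Dataset.IsSeparated {d N C : ℕ} (D : Dataset d N C) (δ : ℝ) (q : ℝ≥0∞) : Prop :=
  IsLeast {r : ℝ | ∃ i j : Fin N, D.label i ≠ D.label j ∧
    r = lpNorm q (D.point i - D.point j)} δ

/-- `f` `(σ, p)`-robustly memorizes `D`: `f = y_i` on the closed ball `B_p^d(x_i, σ)`. -/
def RobustlyMemorizes {d N C : ℕ} (f : (Fin d → ℝ) → ℝ) (D : Dataset d N C)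
    (σ : ℝ) (p : ℝ≥0∞) : Prop :=
  ∀ i : Fin N, ∀ x ∈ lpBall p (D.point i) σ, f x = D.label i

/-- `a_{p,q,d} = (1 / (8 √e)) d ^ (-1/2 + [1/2 - 1/q]₋ + [1/p - 1/2]₋)`, where
`[t]₋ = min {0, t}` and `1 / ∞ = 0`. -/
noncomputable def aConst (p q : ℝ≥0∞) (d : ℕ) : ℝ :=
  1 / (8 * Real.sqrt (Real.exp 1)) *
    (d : ℝ) ^ (-(1 / 2 : ℝ) + min 0 (1 / 2 - (q⁻¹).toReal) + min 0 ((p⁻¹).toReal - 1 / 2))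

end RobustMemo

/-!
Write `m = k - 6`. The network projects `ℝ^d` to `ℝ^m` by `m` linear forms of Euclidean norm at most
`1`, and then works with sup-norm cubes in `ℝ^m`.

*Norms.* The two truncated exponents of `d` in `aConst` are the costs of replacing the `ℓ_p` radius
and the `ℓ_q` separation by Euclidean ones (`lpNorm_two_le`, `lpNorm_le_two`). The radius does not
grow under a form of norm at most `1`.

*Projection.* A random form `⟪r, ·⟫`, with `r` a Gaussian vector scaled by `1 / √(2 d)`, sends a
vector of norm at least `δ` to a value below `u δ / (2 √2 √d)` in absolute value with probability at
most `u / 2`; the other half of `u` pays for the bound on `‖r‖`. By averaging, some form leaves at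
most a fraction `u` of a given finite family unseparated (`exists_unit_few_small`), and `m` forms
chosen one after the other leave at most a fraction `u ^ m`. With `u = N ^ (-2 / m)` this is less
than one pair of data points (`exists_separating_forms`). The sup norm in `ℝ^m` needs only one good
form per pair, so no factor depending on `m` is lost.

*Network.* In `ℝ^m` the cubes around differently labelled points are now disjoint. The network keeps
the `m` projected coordinates, shifted to be nonnegative so that the ReLU does not alter them, and
handles the data points one by one. For each it sums the distances of the coordinates from the
intervals that bound the cube, two layers per coordinate, and replaces its current value by
the maximum with a bump that equals the label on the cube and is nonpositive on the cubes of other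
labels (`exists_net_of_projection`). This takes `N (2 m + 2) + 2` affine maps and fewer than six working
neurons besides the `m` coordinates.
-/

namespace RobustMemo

/-! ### Comparison of `ℓ_p` norms -/

section Norms

variable {d : ℕ}

theorem lpNorm_top_eq_norm (x : Fin d → ℝ) : lpNorm ∞ x = ‖x‖ := by
  rw [lpNorm, PiLp.norm_toLp]

theorem lpNorm_nonneg (p : ℝ≥0∞) (x : Fin d → ℝ) : 0 ≤ lpNorm p x := by
  unfold lpNorm
  rcases p.trichotomy with rfl | rfl | h
  · rw [PiLp.norm_eq_card]; positivity
  · exact norm_nonneg _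
  · rw [PiLp.norm_eq_sum h]; positivity

theorem lpNorm_eq_sum {p : ℝ≥0∞} (hp : 0 < p.toReal) (x : Fin d → ℝ) :
    lpNorm p x = (∑ i, |x i| ^ p.toReal) ^ (1 / p.toReal) := by
  rw [lpNorm, PiLp.norm_eq_sum hp]; rfl

theorem lpNorm_rpow {p : ℝ≥0∞} (hp : 0 < p.toReal) (x : Fin d → ℝ) :
    lpNorm p x ^ p.toReal = ∑ i, |x i| ^ p.toReal := by
  rw [lpNorm_eq_sum hp, one_div, Real.rpow_inv_rpow (by positivity) hp.ne']

theorem abs_apply_le_lpNorm {p : ℝ≥0∞} (hp : 0 < p) (x : Fin d → ℝ) (i : Fin d) :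
    |x i| ≤ lpNorm p x := by
  rcases eq_or_ne p ∞ with rfl | hp'
  · rw [lpNorm_top_eq_norm]; exact norm_le_pi_norm x i
  · have h := ENNReal.toReal_pos hp.ne' hp'
    rw [← Real.rpow_le_rpow_iff (abs_nonneg _) (lpNorm_nonneg _ _) h, lpNorm_rpow h]
    exact Finset.single_le_sum (f := fun i => |x i| ^ p.toReal) (fun _ _ => by positivity)
      (Finset.mem_univ i)

theorem lpNorm_antitone {s r : ℝ≥0∞} (hs : 0 < s) (hsr : s ≤ r) (x : Fin d → ℝ) :
    lpNorm r x ≤ lpNorm s x := by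
  rcases eq_or_ne r ∞ with rfl | hr
  · rw [lpNorm_top_eq_norm]
    exact (pi_norm_le_iff_of_nonneg (lpNorm_nonneg _ _)).2 fun i => abs_apply_le_lpNorm hs x i
  · have hs' := ENNReal.toReal_pos hs.ne' (ne_top_of_le_ne_top hr hsr)
    have hle := ENNReal.toReal_mono hr hsr
    have hr' := hs'.trans_le hle
    have ha := lpNorm_nonneg s x
    rw [← Real.rpow_le_rpow_iff (lpNorm_nonneg _ _) ha hr', lpNorm_rpow hr']
    have key : ∀ {t : ℝ}, 0 ≤ t →
        t ^ r.toReal = t ^ s.toReal * t ^ (r.toReal - s.toReal) := fun ht => by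
      rw [← Real.rpow_add_of_nonneg ht hs'.le (sub_nonneg.2 hle), add_sub_cancel]
    rw [key ha, lpNorm_rpow hs', Finset.sum_mul]
    refine Finset.sum_le_sum fun i _ => ?_
    rw [key (abs_nonneg _)]
    have hi := abs_apply_le_lpNorm hs x i
    have := sub_nonneg.2 hle
    gcongr

/-- For finite exponents this is the power mean inequality with exponent `r / s`. -/
theorem lpNorm_le_rpow_mul_lpNorm {s r : ℝ≥0∞} (hs : 0 < s) (hsr : s ≤ r) (x : Fin d → ℝ) :
    lpNorm s x ≤ (d : ℝ) ^ ((s⁻¹).toReal - (r⁻¹).toReal) * lpNorm r x := by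
  rcases eq_or_ne s ∞ with rfl | hst
  · rw [top_le_iff.1 hsr]; simp
  have hs' := ENNReal.toReal_pos hs.ne' hst
  have hb := lpNorm_nonneg r x
  rw [← Real.rpow_le_rpow_iff (lpNorm_nonneg _ _) (by positivity) hs', lpNorm_rpow hs',
    Real.mul_rpow (by positivity) hb, ← Real.rpow_mul (by positivity), ENNReal.toReal_inv,
    ENNReal.toReal_inv, sub_mul, inv_mul_cancel₀ hs'.ne']
  rcases eq_or_ne r ∞ with rfl | hr
  · refine (Finset.sum_le_card_nsmul _ _ (lpNorm ∞ x ^ s.toReal) fun i _ => ?_).trans_eq ?_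
    · gcongr
      exact abs_apply_le_lpNorm (by simp) x i
    · simp
  · have hle := ENNReal.toReal_mono hr hsr
    have hr' := hs'.trans_le hle
    have h1 : 1 ≤ r.toReal / s.toReal := (one_le_div hs').2 hle
    have h := Real.rpow_sum_le_const_mul_sum_rpow Finset.univ (fun i => |x i| ^ s.toReal) h1
    have e : ∀ i, |(|x i| ^ s.toReal)| = |x i| ^ s.toReal := fun i =>
      abs_of_nonneg (by positivity)
    simp only [e, ← Real.rpow_mul (abs_nonneg _), mul_div_cancel₀ _ hs'.ne', Finset.card_univ,
      Fintype.card_fin, ← lpNorm_rpow hr'] at h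
    have h' := Real.rpow_le_rpow (by positivity) h (show 0 ≤ s.toReal / r.toReal by positivity)
    rw [← Real.rpow_mul (by positivity), div_mul_div_cancel₀ hs'.ne', div_self hr'.ne',
      Real.rpow_one, Real.mul_rpow (by positivity) (by positivity), ← Real.rpow_mul (by positivity),
      ← Real.rpow_mul hb, mul_div_cancel₀ _ hr'.ne'] at h'
    convert h' using 3
    field_simp

theorem lpNorm_two_le {p : ℝ≥0∞} (hp : 0 < p) (x : Fin d → ℝ) :
    lpNorm 2 x ≤ (d : ℝ) ^ (-min 0 ((p⁻¹).toReal - 1 / 2)) * lpNorm p x := by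
  rcases le_total p 2 with h | h
  · have : (1 / 2 : ℝ) ≤ (p⁻¹).toReal := by
      have := ENNReal.toReal_mono (ENNReal.inv_ne_top.2 hp.ne') (ENNReal.inv_le_inv.2 h)
      simpa using this
    rw [min_eq_left (by linarith)]
    simpa using lpNorm_antitone hp h x
  · have : (p⁻¹).toReal ≤ 1 / 2 := by
      have := ENNReal.toReal_mono (by simp) (ENNReal.inv_le_inv.2 h)
      simpa using this
    rw [min_eq_right (by linarith), neg_sub]
    simpa using lpNorm_le_rpow_mul_lpNorm (by simp) h x

theorem lpNorm_le_two {q : ℝ≥0∞} (hq : 0 < q) (x : Fin d → ℝ) :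
    lpNorm q x ≤ (d : ℝ) ^ (-min 0 (1 / 2 - (q⁻¹).toReal)) * lpNorm 2 x := by
  rcases le_total q 2 with h | h
  · have : (1 / 2 : ℝ) ≤ (q⁻¹).toReal := by
      have := ENNReal.toReal_mono (ENNReal.inv_ne_top.2 hq.ne') (ENNReal.inv_le_inv.2 h)
      simpa using this
    rw [min_eq_right (by linarith), neg_sub]
    simpa using lpNorm_le_rpow_mul_lpNorm hq h x
  · have : (q⁻¹).toReal ≤ 1 / 2 := by
      have := ENNReal.toReal_mono (by simp) (ENNReal.inv_le_inv.2 h)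
      simpa using this
    rw [min_eq_left (by linarith)]
    simpa using lpNorm_antitone (by simp) h x

end Norms

/-! ### Gaussian averaging -/

section Gaussian
open MeasureTheory ProbabilityTheory
open scoped RealInnerProductSpace

/-- Anticoncentration: the density of a centred Gaussian of variance `v` is at most
`1 / (2 √v)`. -/
theorem gaussianReal_Icc_le {v : NNReal} (hv : v ≠ 0) {a : ℝ} (ha : 0 ≤ a) :
    (gaussianReal 0 v).real (Set.Icc (-a) a) ≤ a / √v := by
  have hpdf : ∀ x, gaussianPDF 0 v x ≤ ENNReal.ofReal (1 / (2 * √v)) := by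
    intro x
    refine ENNReal.ofReal_le_ofReal ?_
    have hv' : (0 : ℝ) < v := by positivity
    have h2 : 2 * √(v : ℝ) ≤ √(2 * Real.pi * v) := by
      refine Real.le_sqrt_of_sq_le ?_
      rw [mul_pow, Real.sq_sqrt hv'.le]
      nlinarith [Real.pi_gt_three]
    rw [gaussianPDFReal, ← one_div]
    calc _ ≤ 1 / √(2 * Real.pi * v) * 1 := by
            gcongr
            rw [Real.exp_le_one_iff]
            have : 0 ≤ (x - 0) ^ 2 / (2 * (v : ℝ)) := by positivity
            rw [neg_div]
            linarith
      _ ≤ _ := by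
            rw [mul_one]
            gcongr
  have h : gaussianReal 0 v (Set.Icc (-a) a) ≤ ENNReal.ofReal (a / √v) := by
    rw [gaussianReal_apply _ hv]
    calc _ ≤ ∫⁻ _ in Set.Icc (-a) a, ENNReal.ofReal (1 / (2 * √v)) := lintegral_mono hpdf
      _ = ENNReal.ofReal (a / √v) := by
          rw [setLIntegral_const, Real.volume_Icc, ← ENNReal.ofReal_mul (by positivity)]
          congr 1
          field_simp
          ring
  exact ENNReal.toReal_le_of_le_ofReal (by positivity) h

variable {E : Type*} [NormedAddCommGroup E] [InnerProductSpace ℝ E] [FiniteDimensional ℝ E]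
  [MeasurableSpace E] [BorelSpace E]

theorem stdGaussian_abs_inner_le {v : E} (hv : v ≠ 0) {a : ℝ} (ha : 0 ≤ a) :
    (stdGaussian E).real {g | |⟪v, g⟫| ≤ a} ≤ a / ‖v‖ := by
  have hmap := IsGaussian.map_eq_gaussianReal (μ := stdGaussian E) (innerSL ℝ v)
  rw [integral_strongDual_stdGaussian, variance_dual_stdGaussian, innerSL_apply_norm] at hmap
  have hset : {g : E | |⟪v, g⟫| ≤ a} = (innerSL ℝ v) ⁻¹' Set.Icc (-a) a := by
    ext g; simp [abs_le]
  have h := gaussianReal_Icc_le (v := (‖v‖ ^ 2).toNNReal) (by simpa using hv) ha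
  rw [← hmap, map_measureReal_apply (by fun_prop) measurableSet_Icc, ← hset,
    Real.coe_toNNReal _ (by positivity), Real.sqrt_sq (norm_nonneg _)] at h
  exact h

theorem integrable_norm_sq_stdGaussian : Integrable (fun g : E => ‖g‖ ^ 2) (stdGaussian E) :=
  (IsGaussian.memLp_two_id (μ := stdGaussian E)).integrable_norm_pow (by simp)

theorem integral_norm_sq_stdGaussian :
    ∫ g : E, ‖g‖ ^ 2 ∂(stdGaussian E) = (Module.finrank ℝ E : ℝ) := by
  let hb := stdOrthonormalBasis ℝ E
  have hL : ∀ i, MemLp (fun g : E => ⟪hb i, g⟫) 2 (stdGaussian E) := fun i =>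
    (IsGaussian.memLp_two_id (μ := stdGaussian E)).const_inner (hb i)
  have h : ∀ i, ∫ g : E, ⟪hb i, g⟫ ^ 2 ∂(stdGaussian E) = 1 := by
    intro i
    have hvar := variance_dual_stdGaussian (innerSL ℝ (hb i))
    rw [innerSL_apply_norm, hb.norm_eq_one, variance_of_integral_eq_zero (by fun_prop)
      (integral_strongDual_stdGaussian _)] at hvar
    simpa using hvar
  simp_rw [← hb.sum_sq_inner_right]
  rw [integral_finsetSum _ fun i _ => (hL i).integrable_sq]
  simp [h]

/-- For a Gaussian vector `g`, the expected number of `i` with `|⟪v i, g⟫| ≤ (u / 2) δ` is at most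
`(u / 2) #S`, while `E ‖g‖² = dim E`; so some `g` of norm at most `√(2 dim E)` has at most `u #S`
such `i`, and it is rescaled into the unit ball. -/
theorem exists_unit_few_small {ι : Type*} (S : Finset ι) (v : ι → E) {δ u : ℝ} (hδ : 0 < δ)
    (hu : 0 < u) (hv : ∀ i ∈ S, δ ≤ ‖v i‖) (hE : 0 < Module.finrank ℝ E) :
    ∃ r : E, ‖r‖ ≤ 1 ∧
      ((S.filter fun i => |⟪v i, r⟫| ≤ u / (2 * √2 * √(Module.finrank ℝ E)) * δ).card : ℝ) ≤
        u * S.card := by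
  rcases S.eq_empty_or_nonempty with rfl | hS
  · exact ⟨0, by simp, by simp⟩
  set n : ℝ := (Module.finrank ℝ E : ℝ) with hn
  have hn0 : 0 < n := by rw [hn]; exact_mod_cast hE
  have hS' : (0 : ℝ) < S.card := by exact_mod_cast hS.card_pos
  have hmeas : ∀ i, MeasurableSet {g : E | |⟪v i, g⟫| ≤ u / 2 * δ} := fun i =>
    measurableSet_le (by fun_prop) measurable_const
  have hint : ∀ i, Integrable ({g : E | |⟪v i, g⟫| ≤ u / 2 * δ}.indicator (1 : E → ℝ))
      (stdGaussian E) := fun i => (integrable_const (1 : ℝ)).indicator (hmeas i)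
  -- Both the number of nearly orthogonal vectors and `‖g‖²` have to be controlled at once, so
  -- their weighted sum is averaged.
  obtain ⟨g, hg⟩ := exists_le_integral (μ := stdGaussian E)
    (f := fun g => (∑ i ∈ S, {g : E | |⟪v i, g⟫| ≤ u / 2 * δ}.indicator (1 : E → ℝ) g) +
      u / 2 * S.card / n * ‖g‖ ^ 2)
    ((integrable_finsetSum _ fun i _ => hint i).add (integrable_norm_sq_stdGaussian.const_mul _))
  rw [integral_add (integrable_finsetSum _ fun i _ => hint i)
    (integrable_norm_sq_stdGaussian.const_mul _), integral_const_mul,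
    integral_norm_sq_stdGaussian, integral_finsetSum _ fun i _ => hint i] at hg
  have hsum : ∑ i ∈ S, ∫ g, {g : E | |⟪v i, g⟫| ≤ u / 2 * δ}.indicator (1 : E → ℝ) g
      ∂(stdGaussian E) ≤ u / 2 * S.card := by
    rw [mul_comm (u / 2) (S.card : ℝ), ← nsmul_eq_mul]
    refine Finset.sum_le_card_nsmul _ _ _ fun i hi => ?_
    rw [integral_indicator_one (hmeas i)]
    have hvi : 0 < ‖v i‖ := hδ.trans_le (hv i hi)
    refine (stdGaussian_abs_inner_le (norm_pos_iff.1 hvi) (by positivity)).trans ?_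
    rw [div_le_iff₀ hvi]
    exact mul_le_mul_of_nonneg_left (hv i hi) (by positivity)
  have hcard : ∑ i ∈ S, {g : E | |⟪v i, g⟫| ≤ u / 2 * δ}.indicator (1 : E → ℝ) g =
      (S.filter fun i => |⟪v i, g⟫| ≤ u / 2 * δ).card := by
    rw [Finset.card_filter]
    push_cast
    exact Finset.sum_congr rfl fun i _ => by simp [Set.indicator_apply]
  have htot : ((S.filter fun i => |⟪v i, g⟫| ≤ u / 2 * δ).card : ℝ) +
      u / 2 * S.card / n * ‖g‖ ^ 2 ≤ u * S.card := by
    rw [← hcard]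
    rw [← hn, div_mul_cancel₀ _ hn0.ne'] at hg
    linarith
  have hc0 : (0 : ℝ) ≤ (S.filter fun i => |⟪v i, g⟫| ≤ u / 2 * δ).card := Nat.cast_nonneg _
  have hnorm : ‖g‖ ≤ √2 * √n := by
    rw [← Real.sqrt_mul (by norm_num)]
    refine Real.le_sqrt_of_sq_le ?_
    have h1 : u / 2 * S.card / n * ‖g‖ ^ 2 ≤ u / 2 * S.card / n * (2 * n) := by
      have : u / 2 * S.card / n * (2 * n) = u * S.card := by field_simp
      linarith
    exact le_of_mul_le_mul_left h1 (by positivity)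
  have hpos : 0 < √2 * √n := by positivity
  refine ⟨(√2 * √n)⁻¹ • g, ?_, ?_⟩
  · rw [norm_smul, norm_inv, Real.norm_of_nonneg hpos.le, inv_mul_le_one₀ hpos]
    exact hnorm
  · have heq : (S.filter fun i => |⟪v i, (√2 * √n)⁻¹ • g⟫| ≤ u / (2 * √2 * √n) * δ) =
        S.filter fun i => |⟪v i, g⟫| ≤ u / 2 * δ := by
      refine Finset.filter_congr fun i _ => ?_
      rw [real_inner_smul_right, abs_mul, abs_inv, abs_of_pos hpos, inv_mul_le_iff₀ hpos]
      have : √2 * √n * (u / (2 * √2 * √n) * δ) = u / 2 * δ := by field_simp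
      rw [this]
    rw [heq]
    have : 0 ≤ u / 2 * S.card / n * ‖g‖ ^ 2 := by positivity
    linarith

/-- Iteration of `exists_unit_few_small`: each new vector is chosen for the indices that the
previous ones have left. -/
theorem exists_units_few_small {ι : Type*} (v : ι → E) {δ u : ℝ} (hδ : 0 < δ)
    (hu : 0 < u) (hE : 0 < Module.finrank ℝ E) (m : ℕ) (S : Finset ι)
    (hv : ∀ i ∈ S, δ ≤ ‖v i‖) :
    ∃ r : Fin m → E, (∀ l, ‖r l‖ ≤ 1) ∧
      ((S.filter fun i => ∀ l, |⟪v i, r l⟫| ≤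
        u / (2 * √2 * √(Module.finrank ℝ E)) * δ).card : ℝ) ≤ u ^ m * S.card := by
  induction m generalizing S with
  | zero => exact ⟨Fin.elim0, fun l => l.elim0, by simp⟩
  | succ m ih =>
    obtain ⟨r₀, h₀, hc₀⟩ := exists_unit_few_small S v hδ hu hv hE
    obtain ⟨r, h, hc⟩ := ih (S.filter fun i => |⟪v i, r₀⟫| ≤
      u / (2 * √2 * √(Module.finrank ℝ E)) * δ) fun i hi => hv i (Finset.mem_filter.1 hi).1
    refine ⟨Fin.cons r₀ r, fun l => ?_, ?_⟩
    · refine Fin.cases ?_ (fun l => ?_) l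
      · simpa using h₀
      · simpa using h l
    · simp only [Fin.forall_fin_succ, Fin.cons_zero, Fin.cons_succ, ← Finset.filter_filter]
      refine hc.trans ?_
      rw [pow_succ, mul_assoc (u ^ m)]
      exact mul_le_mul_of_nonneg_left hc₀ (by positivity)

end Gaussian

/-! ### ReLU networks taking maxima of bumps -/

/-- `f` is an affine function of the `n` coordinates, as the input of a single neuron is. -/
def IsAffineForm {n : ℕ} (f : (Fin n → ℝ) → ℝ) : Prop :=
  ∃ (a : Fin n → ℝ) (b : ℝ), ∀ w, f w = a ⬝ᵥ w + b

namespace IsAffineForm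

variable {n : ℕ} {f g : (Fin n → ℝ) → ℝ}

theorem const (b : ℝ) : IsAffineForm (fun _ : Fin n → ℝ => b) := ⟨0, b, by simp⟩

theorem coord (i : Fin n) : IsAffineForm (fun w : Fin n → ℝ => w i) :=
  ⟨Pi.single i 1, 0, by simp⟩

theorem add (hf : IsAffineForm f) (hg : IsAffineForm g) : IsAffineForm (fun w => f w + g w) := by
  obtain ⟨a, b, h⟩ := hf
  obtain ⟨a', b', h'⟩ := hg
  exact ⟨a + a', b + b', fun w => by simp only [h, h', add_dotProduct]; ring⟩

theorem const_mul (c : ℝ) (hf : IsAffineForm f) : IsAffineForm (fun w => c * f w) := by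
  obtain ⟨a, b, h⟩ := hf
  exact ⟨c • a, c * b, fun w => by simp only [h, smul_dotProduct, smul_eq_mul]; ring⟩

theorem sub (hf : IsAffineForm f) (hg : IsAffineForm g) : IsAffineForm (fun w => f w - g w) := by
  simpa [sub_eq_add_neg] using hf.add (hg.const_mul (-1))

end IsAffineForm

/-- `T` is the composition of `n` hidden layers of `k` neurons each. It is encoded by its effect on
networks: `T` can be put in front of any network of width at most `k`. -/
def IsLayerChain {k : ℕ} (n : ℕ) (T : (Fin k → ℝ) → (Fin k → ℝ)) : Prop :=
  ∀ (m : ℕ) (g : ReLUNet k m), g.width ≤ k →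
    ∃ g' : ReLUNet k m, g'.width ≤ k ∧ g'.depth = g.depth + n ∧ ∀ w, g'.eval w = g.eval (T w)

namespace IsLayerChain

variable {k : ℕ}

theorem id : IsLayerChain 0 (fun w : Fin k → ℝ => w) := 
  fun _ g hg => ⟨g, hg, rfl, fun _ => rfl⟩

theorem comp {n n' : ℕ} {T T' : (Fin k → ℝ) → (Fin k → ℝ)} (hT' : IsLayerChain n' T')
    (hT : IsLayerChain n T) : IsLayerChain (n + n') (fun w => T' (T w)) := by
  intro m g hg
  obtain ⟨g₁, hw₁, hd₁, he₁⟩ := hT' m g hg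
  obtain ⟨g₂, hw₂, hd₂, he₂⟩ := hT m g₁ hw₁
  exact ⟨g₂, hw₂, by omega, fun w => by rw [he₂, he₁]⟩

theorem layer {G : (Fin k → ℝ) → (Fin k → ℝ)} (hG : ∀ i, IsAffineForm fun w => G w i) :
    IsLayerChain 1 (fun w i => max 0 (G w i)) := by
  choose a b h using hG
  intro m g hg
  refine ⟨.hidden (Matrix.of a) b g, by simp [ReLUNet.width, hg], rfl, fun w => ?_⟩
  simp only [ReLUNet.eval, h]
  rfl

end IsLayerChain

section Construction

variable {m : ℕ}

/-- The values of `m + 6` neurons: a point `z` of `ℝ^m`, two accumulators `s` and `f`, a scratch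
value `a` and its companion `b`; the last two neurons are idle. -/
def state (z : Fin m → ℝ) (s f a b : ℝ) : Fin (m + 6) → ℝ :=
  Fin.append z ![s, f, a, b, 0, 0]

/-- A layer that keeps the `m` stored coordinates and applies affine forms to get the new values of
the four working neurons. -/
theorem exists_layer_state {S F A B : (Fin (m + 6) → ℝ) → ℝ} (hS : IsAffineForm S)
    (hF : IsAffineForm F) (hA : IsAffineForm A) (hB : IsAffineForm B) :
    ∃ T : (Fin (m + 6) → ℝ) → (Fin (m + 6) → ℝ), IsLayerChain 1 T ∧
      ∀ z : Fin m → ℝ, 0 ≤ z → ∀ s f a b, T (state z s f a b) =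
        state z (max 0 (S (state z s f a b))) (max 0 (F (state z s f a b)))
          (max 0 (A (state z s f a b))) (max 0 (B (state z s f a b))) := by
  refine ⟨_, IsLayerChain.layer (G := fun w => Fin.append (fun l => w (Fin.castAdd 6 l))
    ![S w, F w, A w, B w, 0, 0]) ?_, ?_⟩
  · intro i
    refine Fin.addCases (fun l => ?_) (fun j => ?_) i
    · simpa only [Fin.append_left] using IsAffineForm.coord _
    · simp only [Fin.append_right]
      fin_cases j
      · exact hS
      · exact hF
      · exact hA
      · exact hB
      · exact .const 0
      · exact .const 0
  · intro z hz s f a b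
    funext i
    generalize hw : state z s f a b = w
    refine Fin.addCases (fun l => ?_) (fun j => ?_) i
    · simp only [state, Fin.append_left, ← hw]
      exact max_eq_right (hz l)
    · simp only [state, Fin.append_right]
      fin_cases j <;> simp

@[simp] theorem state_castAdd (z : Fin m → ℝ) (s f a b : ℝ) (l : Fin m) :
    state z s f a b (Fin.castAdd 6 l) = z l := by simp [state]

@[simp] theorem state_natAdd_zero (z : Fin m → ℝ) (s f a b : ℝ) :
    state z s f a b (Fin.natAdd m 0) = s := by simp [state]

@[simp] theorem state_natAdd_one (z : Fin m → ℝ) (s f a b : ℝ) :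
    state z s f a b (Fin.natAdd m 1) = f := by simp [state]

@[simp] theorem state_natAdd_two (z : Fin m → ℝ) (s f a b : ℝ) :
    state z s f a b (Fin.natAdd m 2) = a := by simp [state]

@[simp] theorem state_natAdd_three (z : Fin m → ℝ) (s f a b : ℝ) :
    state z s f a b (Fin.natAdd m 3) = b := by simp [state]

/-- The distance of `t` from the interval `[c - ρ, c + ρ]` (for `0 ≤ ρ`), as a sum of two ReLUs. -/
def excess (ρ c t : ℝ) : ℝ := max 0 (t - c - ρ) + max 0 (c - t - ρ)

theorem excess_nonneg (ρ c t : ℝ) : 0 ≤ excess ρ c t :=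
  add_nonneg (le_max_left _ _) (le_max_left _ _)

theorem excess_eq_zero {ρ c t : ℝ} (h : |t - c| ≤ ρ) : excess ρ c t = 0 := by
  rw [abs_le] at h
  rw [excess, max_eq_left (by linarith), max_eq_left (by linarith), add_zero]

theorem sub_le_excess (ρ c t : ℝ) : |t - c| - ρ ≤ excess ρ c t := by
  have h₁ := le_max_left 0 (t - c - ρ)
  have h₂ := le_max_left 0 (c - t - ρ)
  have h₃ := le_max_right 0 (t - c - ρ)
  have h₄ := le_max_right 0 (c - t - ρ)
  unfold excess
  rcases abs_cases (t - c) with ⟨h, -⟩ | ⟨h, -⟩ <;> rw [h] <;> linarith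

theorem exists_chain_add_excess (ρ c : ℝ) (l : Fin m) :
    ∃ T : (Fin (m + 6) → ℝ) → (Fin (m + 6) → ℝ), IsLayerChain 2 T ∧
      ∀ z : Fin m → ℝ, 0 ≤ z → ∀ s f, 0 ≤ s → 0 ≤ f →
        T (state z s f 0 0) = state z (s + excess ρ c (z l)) f 0 0 := by
  have coord := fun i => IsAffineForm.coord (n := m + 6) i
  obtain ⟨T₁, h₁, e₁⟩ := exists_layer_state (m := m) (coord (Fin.natAdd m 0))
    (coord (Fin.natAdd m 1))
    (((coord (Fin.castAdd 6 l)).sub (.const c)).sub (.const ρ))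
    (((IsAffineForm.const c).sub (coord (Fin.castAdd 6 l))).sub (.const ρ))
  obtain ⟨T₂, h₂, e₂⟩ := exists_layer_state (m := m)
    ((coord (Fin.natAdd m 0)).add ((coord (Fin.natAdd m 2)).add (coord (Fin.natAdd m 3))))
    (coord (Fin.natAdd m 1)) (.const 0) (.const 0)
  refine ⟨_, h₂.comp h₁, fun z hz s f hs hf => ?_⟩
  simp only [e₁ z hz, e₂ z hz, state_castAdd, state_natAdd_zero, state_natAdd_one,
    state_natAdd_two, state_natAdd_three, max_eq_right hs, max_eq_right hf, max_self]
  rw [← excess, max_eq_right (add_nonneg hs (excess_nonneg ρ c (z l)))]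

theorem exists_chain_sum_excess (ρ : ℝ) (c : Fin m → ℝ) (L : Finset (Fin m)) :
    ∃ T : (Fin (m + 6) → ℝ) → (Fin (m + 6) → ℝ), IsLayerChain (2 * L.card) T ∧
      ∀ z : Fin m → ℝ, 0 ≤ z → ∀ s f, 0 ≤ s → 0 ≤ f →
        T (state z s f 0 0) = state z (s + ∑ l ∈ L, excess ρ (c l) (z l)) f 0 0 := by
  induction L using Finset.induction_on with
  | empty => exact ⟨_, IsLayerChain.id, by simp⟩
  | insert l L hl ih =>
    obtain ⟨T, hT, e⟩ := ih
    obtain ⟨T', hT', e'⟩ := exists_chain_add_excess ρ (c l) l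
    refine ⟨fun w => T' (T w), ?_, fun z hz s f hs hf => ?_⟩
    · rw [Finset.card_insert_of_notMem hl, mul_add, mul_one]
      exact hT'.comp hT
    · simp only [e z hz s f hs hf]
      rw [e' z hz _ f (add_nonneg hs (Finset.sum_nonneg fun _ _ => excess_nonneg _ _ _)) hf,
        Finset.sum_insert hl, add_assoc, add_comm (excess _ _ _)]

/-- A bump of height `y` around the cube of radius `ρ` centred at `c`; it is nonpositive as soon as
one coordinate leaves `[c l - ρ, c l + ρ]` by at least `1 / K`. -/
def bump (ρ K : ℝ) (c : Fin m → ℝ) (y : ℝ) (z : Fin m → ℝ) : ℝ :=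
  y - y * K * ∑ l, excess ρ (c l) (z l)

theorem exists_chain_max_bump (ρ K : ℝ) (c : Fin m → ℝ) (y : ℝ) :
    ∃ T : (Fin (m + 6) → ℝ) → (Fin (m + 6) → ℝ), IsLayerChain (2 * m + 2) T ∧
      ∀ z : Fin m → ℝ, 0 ≤ z → ∀ f, 0 ≤ f →
        T (state z 0 f 0 0) = state z 0 (max (bump ρ K c y z) f) 0 0 := by
  have coord := fun i => IsAffineForm.coord (n := m + 6) i
  obtain ⟨T, hT, e⟩ := exists_chain_sum_excess ρ c Finset.univ
  obtain ⟨T₁, h₁, e₁⟩ := exists_layer_state (m := m) (.const 0) (coord (Fin.natAdd m 1))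
    (((IsAffineForm.const y).sub ((coord (Fin.natAdd m 0)).const_mul (y * K))).sub
      (coord (Fin.natAdd m 1))) (.const 0)
  obtain ⟨T₂, h₂, e₂⟩ := exists_layer_state (m := m) (.const 0)
    ((coord (Fin.natAdd m 1)).add (coord (Fin.natAdd m 2))) (.const 0) (.const 0)
  refine ⟨fun w => T₂ (T₁ (T w)), ?_, fun z hz f hf => ?_⟩
  · have := (h₂.comp h₁).comp hT
    simpa only [Finset.card_univ, Fintype.card_fin] using this
  · simp only [e z hz 0 f le_rfl hf, e₁ z hz, e₂ z hz, state_natAdd_zero, state_natAdd_one,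
      state_natAdd_two, max_eq_right hf, max_self, zero_add]
    rw [← bump]
    -- The second layer computes `f + [bump - f]₊ = max bump f`.
    have : f + max 0 (bump ρ K c y z - f) = max (bump ρ K c y z) f := by
      rw [← max_add_add_left, add_zero, add_sub_cancel, max_comm]
    rw [this, max_eq_right (hf.trans (le_max_right _ _))]

theorem exists_chain_fold_max_bump {ι : Type*} [DecidableEq ι] (ρ K : ℝ) (c : ι → Fin m → ℝ)
    (y : ι → ℝ) (S : Finset ι) :
    ∃ T : (Fin (m + 6) → ℝ) → (Fin (m + 6) → ℝ), IsLayerChain (S.card * (2 * m + 2)) T ∧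
      ∀ z : Fin m → ℝ, 0 ≤ z → T (state z 0 0 0 0) =
        state z 0 (S.fold max 0 fun i => bump ρ K (c i) (y i) z) 0 0 := by
  induction S using Finset.induction_on with
  | empty => exact ⟨fun w => w, by simpa using IsLayerChain.id, by simp⟩
  | insert i S hi ih =>
    obtain ⟨T, hT, e⟩ := ih
    obtain ⟨T', hT', e'⟩ := exists_chain_max_bump ρ K (c i) (y i)
    refine ⟨fun w => T' (T w), ?_, fun z hz => ?_⟩
    · rw [Finset.card_insert_of_notMem hi, add_mul, one_mul]
      exact hT'.comp hT
    · simp only [e z hz]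
      rw [e' z hz _ ((Finset.le_fold_max 0).2 (Or.inl le_rfl)), Finset.fold_insert hi]

/-- The network: project to `ℝ^m`, shift into the positive orthant, and take the maximum of the
bumps around the projected data points. -/
theorem exists_net_fold_max_bump {d : ℕ} {ι : Type*} [Fintype ι] [DecidableEq ι] (ρ K : ℝ)
    (r : Fin m → Fin d → ℝ) (β : ℝ) (c : ι → Fin m → ℝ) (y : ι → ℝ) :
    ∃ F : ReLUNet d 1, F.width = m + 6 ∧ F.depth = Fintype.card ι * (2 * m + 2) + 2 ∧
      ∀ x, (∀ l, 0 ≤ r l ⬝ᵥ x + β) → F.toFun x =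
        Finset.univ.fold max 0 fun i => bump ρ K (c i) (y i) fun l => r l ⬝ᵥ x + β := by
  obtain ⟨T, hT, e⟩ := exists_chain_fold_max_bump ρ K c y Finset.univ
  obtain ⟨g, hw, hd, he⟩ := hT 1 (.affine (Matrix.of fun _ : Fin 1 =>
    (Pi.single (Fin.natAdd m 1) 1 : Fin (m + 6) → ℝ)) 0) (Nat.zero_le _)
  refine ⟨.hidden (Matrix.of (Fin.append r 0)) (Fin.append (fun _ => β) 0) g, ?_, ?_,
    fun x hx => ?_⟩
  · simpa [ReLUNet.width] using hw
  · simp only [ReLUNet.depth, hd, Finset.card_univ]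
    ring
  · have h0 : (fun i => max 0 (((Matrix.of (Fin.append r (0 : Fin 6 → Fin d → ℝ))).mulVec x +
        (Fin.append (fun _ => β) 0 : Fin (m + 6) → ℝ)) i)) =
        state (fun l => r l ⬝ᵥ x + β) 0 0 0 0 := by
      funext i
      refine Fin.addCases (fun l => ?_) (fun j => ?_) i
      · simp [Matrix.mulVec, hx l]
      · simp only [Matrix.mulVec, state, Pi.add_apply, Matrix.of_apply, Fin.append_right]
        fin_cases j <;> simp
    rw [ReLUNet.toFun, ReLUNet.eval, h0, he, e _ (fun l => hx l)]
    simp [ReLUNet.eval, Matrix.mulVec]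

/-- If projected points with different labels are more than `2ρ` apart in the sup norm, uniformly,
then some network is constant, with the right value, on all points whose projection is
`ρ`-close to that of a data point. -/
theorem exists_net_of_projection {d N C : ℕ} (D : Dataset d N C) (r : Fin m → Fin d → ℝ) {ρ T : ℝ}
    (hT : 2 * ρ < T)
    (hsep : ∀ i j, D.label i ≠ D.label j → ∃ l, T ≤ |r l ⬝ᵥ (D.point i - D.point j)|) :
    ∃ F : ReLUNet d 1, F.width = m + 6 ∧ F.depth = N * (2 * m + 2) + 2 ∧
      ∀ i x, (∀ l, |r l ⬝ᵥ (x - D.point i)| ≤ ρ) → F.toFun x = D.label i := by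
  set β : ℝ := (∑ i, ∑ l, |r l ⬝ᵥ D.point i|) + ρ with hβ
  obtain ⟨F, hw, hd, he⟩ := exists_net_fold_max_bump ρ (T - 2 * ρ)⁻¹ r β
    (fun i l => r l ⬝ᵥ D.point i + β) (fun i => (D.label i : ℝ))
  refine ⟨F, hw, by simpa using hd, fun i x hx => ?_⟩
  have hpos : ∀ l, 0 ≤ r l ⬝ᵥ x + β := by
    intro l
    have h₁ : |r l ⬝ᵥ D.point i| ≤ ∑ i, ∑ l, |r l ⬝ᵥ D.point i| :=
      (Finset.single_le_sum (f := fun l => |r l ⬝ᵥ D.point i|) (fun _ _ => abs_nonneg _)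
        (Finset.mem_univ l)).trans
      (Finset.single_le_sum (f := fun i => ∑ l, |r l ⬝ᵥ D.point i|)
        (fun _ _ => Finset.sum_nonneg fun _ _ => abs_nonneg _) (Finset.mem_univ i))
    have h₂ := hx l
    rw [dotProduct_sub] at h₂
    have h₃ := (abs_le.1 h₂).1
    have h₄ := (abs_le.1 h₁).1
    rw [hβ]
    linarith
  rw [he x hpos]
  apply le_antisymm
  · refine (Finset.fold_max_le _).2 ⟨Nat.cast_nonneg _, fun j _ => ?_⟩
    have hnn : ∀ l ∈ Finset.univ, 0 ≤ excess ρ (r l ⬝ᵥ D.point j + β) (r l ⬝ᵥ x + β) :=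
      fun _ _ => excess_nonneg _ _ _
    by_cases hij : D.label i = D.label j
    · rw [hij, bump]
      have := inv_nonneg.2 (sub_nonneg.2 hT.le)
      have := mul_nonneg (mul_nonneg (Nat.cast_nonneg (α := ℝ) (D.label j)) this)
        (Finset.sum_nonneg hnn)
      linarith
    · obtain ⟨l, hl⟩ := hsep i j hij
      have h₁ : T - 2 * ρ ≤ ∑ l, excess ρ (r l ⬝ᵥ D.point j + β) (r l ⬝ᵥ x + β) := by
        refine le_trans ?_ ((sub_le_excess _ _ _).trans
          (Finset.single_le_sum hnn (Finset.mem_univ l)))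
        have h₂ := hx l
        rw [dotProduct_sub] at h₂ hl
        have h₃ := abs_sub_le (r l ⬝ᵥ D.point i) (r l ⬝ᵥ x) (r l ⬝ᵥ D.point j)
        rw [abs_sub_comm] at h₂
        rw [add_sub_add_right_eq_sub]
        linarith
      have h₂ : 1 ≤ (T - 2 * ρ)⁻¹ * ∑ l, excess ρ (r l ⬝ᵥ D.point j + β) (r l ⬝ᵥ x + β) := by
        rw [inv_mul_eq_div, one_le_div (by linarith)]
        exact h₁
      have h₃ := mul_le_mul_of_nonneg_left h₂ (Nat.cast_nonneg (α := ℝ) (D.label j))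
      rw [bump]
      have h₄ : (0 : ℝ) ≤ D.label i := Nat.cast_nonneg _
      rw [← mul_assoc] at h₃
      linarith
  · refine (Finset.le_fold_max _).2 (Or.inr ⟨i, Finset.mem_univ i, ?_⟩)
    rw [bump, Finset.sum_eq_zero, mul_zero, sub_zero]
    intro l _
    refine excess_eq_zero ?_
    rw [add_sub_add_right_eq_sub, ← dotProduct_sub]
    exact hx l

end Construction

/-! ### Separating projections -/


/-- Linear forms of Euclidean norm at most `1` that separate every pair of differently labelled
points: choosing the forms one after the other, each keeps only a fraction `N ^ (-2 / m)` of the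
fewer than `N ^ 2` pairs unseparated, so that less than one pair remains after `m` steps. -/
theorem exists_separating_forms {d N C m : ℕ} (hN : 0 < N) (hd : 0 < d) (hm : 0 < m)
    (D : Dataset d N C) {δ : ℝ} (hδ : 0 < δ)
    (hD : ∀ i j, D.label i ≠ D.label j → δ ≤ lpNorm 2 (D.point i - D.point j)) :
    ∃ r : Fin m → Fin d → ℝ, (∀ l x, |r l ⬝ᵥ x| ≤ lpNorm 2 x) ∧
      ∀ i j, D.label i ≠ D.label j → ∃ l,
        (N : ℝ) ^ (-(2 / (m : ℝ))) / (2 * √2 * √d) * δ ≤ |r l ⬝ᵥ (D.point i - D.point j)| := by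
  have hinner : ∀ (x : Fin d → ℝ) (r : EuclideanSpace ℝ (Fin d)),
      inner ℝ (WithLp.toLp 2 x) r = r.ofLp ⬝ᵥ x := fun x r => by
    simp [EuclideanSpace.inner_eq_star_dotProduct]
  have hN' : (0 : ℝ) < N := by exact_mod_cast hN
  set u : ℝ := (N : ℝ) ^ (-(2 / (m : ℝ))) with hu
  have hu0 : 0 < u := by positivity
  have hum : u ^ m = ((N : ℝ) ^ 2)⁻¹ := by
    rw [hu, ← Real.rpow_mul_natCast hN'.le, neg_mul, div_mul_cancel₀ _ (by positivity),
      Real.rpow_neg hN'.le, Real.rpow_two]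
  set S : Finset (Fin N × Fin N) := Finset.univ.offDiag.filter fun a => D.label a.1 ≠ D.label a.2
  have hS : (S.card : ℝ) < (N : ℝ) ^ 2 := by
    have h : S.card ≤ N * N - N := by
      simpa [Finset.offDiag_card] using Finset.card_filter_le (Finset.univ.offDiag)
        fun a : Fin N × Fin N => D.label a.1 ≠ D.label a.2
    have h' : S.card < N ^ 2 := by
      have := Nat.le_mul_self N
      rw [sq]; omega
    exact_mod_cast h'
  obtain ⟨r, hr, hc⟩ := exists_units_few_small (E := EuclideanSpace ℝ (Fin d))
    (fun a : Fin N × Fin N => WithLp.toLp 2 (D.point a.1 - D.point a.2)) hδ hu0 (by simpa using hd)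
    m S fun a ha => hD _ _ (Finset.mem_filter.1 ha).2
  have hempty : ((S.filter fun a => ∀ l, |inner ℝ (WithLp.toLp 2 (D.point a.1 - D.point a.2)) (r l)|
      ≤ u / (2 * √2 * √(Module.finrank ℝ (EuclideanSpace ℝ (Fin d)))) * δ).card : ℝ) < 1 := by
    refine hc.trans_lt ?_
    rwa [hum, inv_mul_lt_iff₀ (by positivity), mul_one]
  rw [Nat.cast_lt_one, Finset.card_eq_zero, Finset.filter_eq_empty_iff] at hempty
  refine ⟨fun l => (r l).ofLp, fun l x => ?_, fun i j hij => ?_⟩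
  · rw [← hinner]
    refine (abs_real_inner_le_norm _ _).trans ?_
    exact mul_le_of_le_one_right (norm_nonneg _) (hr l)
  · have hmem : (i, j) ∈ S := by
      refine Finset.mem_filter.2
        ⟨Finset.mem_offDiag.2 ⟨Finset.mem_univ _, Finset.mem_univ _, ?_⟩, hij⟩
      exact fun h => hij (congrArg D.label h)
    have := hempty hmem
    push Not at this
    obtain ⟨l, hl⟩ := this
    refine ⟨l, ?_⟩
    rw [hinner, finrank_euclideanSpace_fin] at hl
    exact hl.le


end RobustMemo

theorem mainTheorem7 :
    ∃ c : ℝ, 0 < c ∧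
      ∀ (N d C k : ℕ), 2 ≤ N → 2 ≤ d → 2 ≤ C → 7 ≤ k → k ≤ d + 5 →
      ∀ (p q : ℝ≥0∞), 0 < p → 1 ≤ q →
      ∀ (δ σ : ℝ), 0 < δ → 0 ≤ σ →
        σ / δ ≤ RobustMemo.aConst p q d * (N : ℝ) ^ (-(2 / ((k : ℝ) - 6))) →
      ∀ D : RobustMemo.Dataset d N C, D.IsSeparated δ q →
        ∃ F : RobustMemo.ReLUNet d 1,
          F.width = k ∧
          (F.depth : ℝ) ≤ c * ((N : ℝ) * (k : ℝ) * Real.logb 2 (k : ℝ)) ∧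
          RobustMemo.RobustlyMemorizes F.toFun D σ p := by
  refine ⟨2, two_pos, fun N d C k hN hd _ hk _ p q hp hq δ σ hδ hσ hle D hD => ?_⟩
  obtain ⟨m, rfl⟩ : ∃ m, k = m + 6 := ⟨k - 6, by omega⟩
  have hd0 : (0 : ℝ) < d := by exact_mod_cast (by omega : 0 < d)
  have hN0 : (0 : ℝ) < N := by exact_mod_cast (by omega : 0 < N)
  rw [Nat.cast_add, Nat.cast_ofNat, add_sub_cancel_right, div_le_iff₀ hδ, RobustMemo.aConst,
    Real.rpow_add hd0, Real.rpow_add hd0] at hle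
  set eq := min 0 (1 / 2 - (q⁻¹).toReal)
  set ep := min 0 ((p⁻¹).toReal - 1 / 2)
  -- The Euclidean separation of the data.
  have hsep : ∀ i j, D.label i ≠ D.label j →
      (d : ℝ) ^ eq * δ ≤ RobustMemo.lpNorm 2 (D.point i - D.point j) := by
    intro i j hij
    have h := (hD.2 ⟨i, j, hij, rfl⟩).trans (RobustMemo.lpNorm_le_two (zero_lt_one.trans_le hq) _)
    rw [Real.rpow_neg hd0.le] at h
    rwa [le_inv_mul_iff₀ (by positivity)] at h
  obtain ⟨r, hr, hrsep⟩ := RobustMemo.exists_separating_forms (m := m) (by omega) (by omega)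
    (by omega) D (by positivity) hsep
  set u : ℝ := (N : ℝ) ^ (-(2 / (m : ℝ)))
  have hu : 0 < u := by positivity
  -- `8 √e` leaves a factor to spare over the `4 √2` coming from the averaging argument.
  have hgap : 2 * ((d : ℝ) ^ (-ep) * σ) < u / (2 * √2 * √d) * ((d : ℝ) ^ eq * δ) := by
    have h1 : (d : ℝ) ^ (-ep) * σ ≤ u / (8 * √(Real.exp 1) * √d) * ((d : ℝ) ^ eq * δ) := by
      refine (mul_le_mul_of_nonneg_left hle (by positivity)).trans_eq ?_
      rw [Real.rpow_neg hd0.le, Real.rpow_neg hd0.le, ← Real.sqrt_eq_rpow]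
      have : (d : ℝ) ^ ep ≠ 0 := by positivity
      field_simp
    have h2 : u / (4 * √(Real.exp 1) * √d) < u / (2 * √2 * √d) := by
      have h3 : √2 ≤ √(Real.exp 1) := Real.sqrt_le_sqrt (by linarith [Real.exp_one_gt_d9])
      have h4 : 0 < √2 := by positivity
      have h5 : 0 < √(d : ℝ) := by positivity
      gcongr ?_ / ?_
      nlinarith
    have h6 := mul_lt_mul_of_pos_right h2 (show 0 < (d : ℝ) ^ eq * δ by positivity)
    have h7 : u / (4 * √(Real.exp 1) * √d) = 2 * (u / (8 * √(Real.exp 1) * √d)) := by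
      field_simp; norm_num
    rw [h7, mul_assoc] at h6
    linarith
  obtain ⟨F, hw, hdep, hF⟩ := RobustMemo.exists_net_of_projection D r hgap hrsep
  refine ⟨F, hw, ?_, fun i x hx => hF i x fun l => ?_⟩
  · have hlog : 1 ≤ Real.logb 2 ((m + 6 : ℕ) : ℝ) := by
      rw [Real.le_logb_iff_rpow_le one_lt_two (by positivity), Real.rpow_one]
      exact_mod_cast (by omega : 2 ≤ m + 6)
    have h1 : (F.depth : ℝ) ≤ 2 * (N * (m + 6 : ℕ)) := by
      have : F.depth ≤ 2 * (N * (m + 6)) := by rw [hdep]; nlinarith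
      exact_mod_cast this
    refine h1.trans (mul_le_mul_of_nonneg_left ?_ two_pos.le)
    exact le_mul_of_one_le_right (by positivity) hlog
  · refine (hr l _).trans ((RobustMemo.lpNorm_two_le hp _).trans ?_)
    exact mul_le_mul_of_nonneg_left hx (by positivity)
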